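/- Let $H$ be a real or complex Hilbert space and let $T$ be a linear operator in $H$ with dense domain $\operatorname{dom}T$ that is positive symmetric, i.e. $\langle Tf,g\rangle=\langle f,Tg\rangle$ and $\langle Tf,f\rangle\ge 0$ for all $f,g\in\operatorname{dom}T$. Put $$\mathcal D_*(T)=\Bigl\{g\in H:\ \sup\{|\langle Th,g\rangle|^2 : h\in\operatorname{dom}T,\ \langle Th,h\rangle\le 1\}<+\infty\Bigr\}.$$ Let $\mathcal E_T$ (the energy space) be the Hilbert space completion of the range of $T$ with respect to the inner product $\langle Tf,Th\rangle_{T}=\langle Tf,h\rangle$ $(f,h\in\operatorname{dom}T)$, let $J_T:\mathcal E_T\to H$ be the densely defined operator with domain $\operatorname{ran}T\subseteq\mathcal E_T$ given by $J_T(Th)=Th$, and let $Q_T:H\to\mathcal E_T$ be the restriction of $J_T^*$ to $\operatorname{dom}T$. Let $T_N=J_T^{**}J_T^*$ be the Krein–von Neumann extension and $T_F=Q_T^*Q_T^{**}$ the Friedrichs extension of $T$ (products are taken with their natural domains). Then the following statements are equivalent: (i) $T$ has exactly one positive self-adjoint extension; (i') $T_N=T_F$; (ii) $\ker(I+T^*)\cap\mathcal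 D_*(T)=\{0\}$; (iii) for every non-zero $g\in\ker(I+T^*)$, $$\sup\{|\langle f,g\rangle|^2 : f\in\operatorname{dom}T,\ \langle Tf,f\rangle\le 1\}=+\infty.$$ -/

import Mathlib

open scoped ENNReal LinearPMap

noncomputable section

namespace PosExt

universe u v

variable {𝕜 : Type u} {H : Type v} [RCLike 𝕜] [NormedAddCommGroup H] [InnerProductSpace 𝕜 H]

/-- A (not necessarily densely defined) linear operator `T` in `H` is positive if it is symmetric,
`⟪T f, g⟫ = ⟪f, T g⟫` on its domain, and its quadratic form (which is real by symmetry) is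
nonnegative. -/
structure IsPositive (T : H →ₗ.[𝕜] H) : Prop where
  symm : ∀ f g : T.domain, inner 𝕜 (T f) (g : H) = inner 𝕜 (f : H) (T g)
  nonneg : ∀ f : T.domain, 0 ≤ RCLike.re (inner 𝕜 (T f) (f : H))

/-- `S` is a positive self-adjoint extension of `T`. (`IsSelfAdjoint S` means `S† = S` and entails
that `S` is densely defined.) -/
def IsPosSelfAdjointExtension [CompleteSpace H] (T S : H →ₗ.[𝕜] H) : Prop :=
  IsSelfAdjoint S ∧ IsPositive S ∧ T ≤ S

/-- The kernel of a partially defined operator, as a subspace of the ambient space. -/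
def ker {R E F : Type*} [Ring R] [AddCommGroup E] [Module R E] [AddCommGroup F] [Module R F]
    (A : E →ₗ.[R] F) : Submodule R E :=
  (LinearMap.ker A.toFun).map A.domain.subtype

/-- The set `𝓓_*(T)` of all `g` with `sup {|⟪T h, g⟫|² : h ∈ dom T, ⟪T h, h⟫ ≤ 1} < ∞`, the
supremum being taken in `[0, ∞]`. -/
def dStar (T : H →ₗ.[𝕜] H) : Set H :=
  {g | (⨆ h : {h : T.domain // RCLike.re (inner 𝕜 (T h) (h : H)) ≤ 1},
      ‖inner 𝕜 (T h.1) g‖ₑ ^ 2) < ∞}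

/-- The product `B A` of partially defined operators with its natural domain
`{x ∈ dom A | A x ∈ dom B}`. -/
def mulOp {R E F G : Type*} [Ring R] [AddCommGroup E] [Module R E] [AddCommGroup F] [Module R F]
    [AddCommGroup G] [Module R G] (B : F →ₗ.[R] G) (A : E →ₗ.[R] F) : E →ₗ.[R] G :=
  B.comp (A.domRestrict ((B.domain.comap A.toFun).map A.domain.subtype)) (by
    rintro ⟨x, ⟨y, hy, rfl⟩, hx⟩
    exact hy)

theorem mem_graph_mulOp {R E F G : Type*} [Ring R] [AddCommGroup E] [Module R E] [AddCommGroup F]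
    [Module R F] [AddCommGroup G] [Module R G] (B : F →ₗ.[R] G) (A : E →ₗ.[R] F) (x : E) (z : G) :
    (x, z) ∈ (mulOp B A).graph ↔ ∃ y, (x, y) ∈ A.graph ∧ (y, z) ∈ B.graph := by
  simp only [LinearPMap.mem_graph_iff]
  constructor
  · rintro ⟨⟨w, ⟨y, hy, rfl⟩, hw⟩, h1, h2⟩
    exact ⟨A y, ⟨y, h1, rfl⟩, ⟨A y, hy⟩, rfl, h2⟩
  · rintro ⟨_, ⟨a, rfl, rfl⟩, b, hb, rfl⟩
    refine ⟨⟨a, ⟨a, ?_, rfl⟩, a.2⟩, rfl, ?_⟩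
    · change A a ∈ B.domain
      rw [← hb]
      exact b.2
    · change B ⟨A a, _⟩ = B b
      congr 1
      exact Subtype.ext hb.symm

/-! ### The energy space -/

/-- The range of a positive operator `T`, to be endowed with the inner product
`⟪T f, T h⟫ := ⟪T f, h⟫` instead of the one inherited from `H`. -/
def EnergyRange {T : H →ₗ.[𝕜] H} (_hT : IsPositive T) : Type v :=
  LinearMap.range T.toFun

variable {T : H →ₗ.[𝕜] H} (hT : IsPositive T)

instance : AddCommGroup (EnergyRange hT) :=
  inferInstanceAs (AddCommGroup (LinearMap.range T.toFun))

instance : Module 𝕜 (EnergyRange hT) :=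
  inferInstanceAs (Module 𝕜 (LinearMap.range T.toFun))

/-- The inclusion of `ran T` in `H`. -/
def EnergyRange.incl : EnergyRange hT →ₗ[𝕜] H :=
  (LinearMap.range T.toFun).subtype

/-- `T` as a map of `dom T` onto `ran T`. -/
def EnergyRange.mk : T.domain →ₗ[𝕜] EnergyRange hT :=
  T.toFun.rangeRestrict

theorem EnergyRange.incl_mk (h : T.domain) : EnergyRange.incl hT (EnergyRange.mk hT h) = T h :=
  rfl

theorem EnergyRange.mk_surjective : Function.Surjective (EnergyRange.mk hT) :=
  LinearMap.surjective_rangeRestrict _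

/-- The energy inner product `⟪T f, T h⟫ := ⟪T f, h⟫`, where `h` is any preimage of the second
argument (see `energyInner_mk` for the independence of its choice). -/
def energyInner (x y : EnergyRange hT) : 𝕜 :=
  inner 𝕜 (EnergyRange.incl hT x)
    ((Function.surjInv (EnergyRange.mk_surjective hT) y : T.domain) : H)

theorem energyInner_mk (f h : T.domain) :
    energyInner hT (EnergyRange.mk hT f) (EnergyRange.mk hT h) = inner 𝕜 (T f) (h : H) := by
  unfold energyInner
  rw [EnergyRange.incl_mk, hT.symm, hT.symm]
  congr 1
  have := congrArg (EnergyRange.incl hT)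
    (Function.surjInv_eq (EnergyRange.mk_surjective hT) (EnergyRange.mk hT h))
  exact this

/-- The energy inner product on `ran T`. -/
@[reducible]
def energyCore : PreInnerProductSpace.Core 𝕜 (EnergyRange hT) where
  inner := energyInner hT
  conj_inner_symm x y := by
    obtain ⟨f, rfl⟩ := EnergyRange.mk_surjective hT x
    obtain ⟨h, rfl⟩ := EnergyRange.mk_surjective hT y
    rw [energyInner_mk, energyInner_mk, inner_conj_symm, hT.symm]
  re_inner_nonneg x := by
    obtain ⟨f, rfl⟩ := EnergyRange.mk_surjective hT x
    rw [energyInner_mk]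
    exact hT.nonneg f
  add_left x y z := by simp [energyInner, inner_add_left]
  smul_left x y r := by simp [energyInner, inner_smul_left]

instance : SeminormedAddCommGroup (EnergyRange hT) :=
  letI := energyCore hT
  InnerProductSpace.Core.toSeminormedAddCommGroup (𝕜 := 𝕜)

instance : InnerProductSpace 𝕜 (EnergyRange hT) :=
  InnerProductSpace.ofCore (energyCore hT)

theorem EnergyRange.inner_mk (f h : T.domain) :
    inner 𝕜 (EnergyRange.mk hT f) (EnergyRange.mk hT h) = inner 𝕜 (T f) (h : H) :=
  energyInner_mk hT f h

/-- The energy space `𝓔_T` of `T`: the Hilbert space completion of `ran T` with respect to the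
energy inner product. -/
abbrev EnergySpace : Type v := UniformSpace.Completion (EnergyRange hT)

/-- The subspace `{(T h, T h) | h ∈ dom T}` of `𝓔_T × H`. -/
def energyEmbeddingGraph : Submodule 𝕜 (EnergySpace hT × H) :=
  LinearMap.range
    ((UniformSpace.Completion.toComplₗᵢ (𝕜 := 𝕜) (E := EnergyRange hT)).toLinearMap.prod
      (EnergyRange.incl hT))

/-- The natural embedding `J_T` of `ran T ⊆ 𝓔_T` into `H`, `J_T (T h) = T h`. For densely defined
`T` this is well defined by `energyEmbedding_apply`. -/
def energyEmbedding : EnergySpace hT →ₗ.[𝕜] H :=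
  (energyEmbeddingGraph hT).toLinearPMap

theorem norm_mk_sq (h : T.domain) :
    ‖EnergyRange.mk hT h‖ ^ 2 = RCLike.re (inner 𝕜 (T h) (h : H)) := by
  rw [← EnergyRange.inner_mk, ← norm_sq_eq_re_inner]

theorem eq_zero_of_energy_eq_zero (hd : Dense (T.domain : Set H)) (h : T.domain)
    (h0 : ‖EnergyRange.mk hT h‖ = 0) : T h = 0 := by
  refine hd.eq_zero_of_inner_left 𝕜 fun g hg => ?_
  have := norm_inner_le_norm (𝕜 := 𝕜) (EnergyRange.mk hT h) (EnergyRange.mk hT ⟨g, hg⟩)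
  rw [h0, zero_mul, EnergyRange.inner_mk] at this
  exact norm_le_zero_iff.1 this

theorem energyEmbeddingGraph_functional (hd : Dense (T.domain : Set H))
    (x : EnergySpace hT × H) (hx : x ∈ energyEmbeddingGraph hT) (hx0 : x.1 = 0) : x.2 = 0 := by
  obtain ⟨y, rfl⟩ := hx
  obtain ⟨h, rfl⟩ := EnergyRange.mk_surjective hT y
  refine eq_zero_of_energy_eq_zero hT hd h ?_
  rw [← UniformSpace.Completion.norm_coe]
  exact norm_eq_zero.2 hx0

theorem energyEmbedding_apply (hd : Dense (T.domain : Set H)) (h : T.domain) :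
    (((EnergyRange.mk hT h : EnergyRange hT) : EnergySpace hT), T h) ∈
      (energyEmbedding hT).graph := by
  rw [energyEmbedding, Submodule.toLinearPMap_graph_eq _ (energyEmbeddingGraph_functional hT hd)]
  exact ⟨EnergyRange.mk hT h, rfl⟩

variable [CompleteSpace H]

/-- The Krein-von Neumann extension `T_N = J_T** J_T*`. -/
def kreinVonNeumann : H →ₗ.[𝕜] H :=
  mulOp (energyEmbedding hT)†† (energyEmbedding hT)†

/-- The restriction `Q_T` of `J_T*` to `dom T`. -/
def energyRestrict : H →ₗ.[𝕜] EnergySpace hT :=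
  (energyEmbedding hT)†.domRestrict T.domain

/-- The Friedrichs extension `T_F = Q_T* Q_T**`. -/
def friedrichs : H →ₗ.[𝕜] H :=
  mulOp (energyRestrict hT)† (energyRestrict hT)††

end PosExt

end

/-! By construction `dom J_T*` is `𝓓_*(T)`, and `Q_T ⊆ J_T*` gives `Q_T** ⊆ J_T*`. The
graph-orthogonal complement of `Q_T**` in `J_T*` consists of the pairs `(u, J_T* u)` with `⟪f, u⟫ +
⟪T f, u⟫ = 0` for all `f ∈ dom T`, that is, `u ∈ ker (I + T*) ∩ 𝓓_*(T)`. So (ii) says exactly that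
`dom T` is a core for `J_T*`.

If it is a core, every positive self-adjoint extension has its domain in `𝓓_*(T) = dom Q_T**`, hence
is contained in `T_F`, hence equals it (`eq_friedrichs_of_core`). Conversely, if `T_N = T_F` and `g`
is in the intersection, then `f = (I + T_N)⁻¹ g` lies in `dom Q_T**`, and graph-orthogonality gives
`⟪g, f + T_N f⟫ = 0`, so `g = 0`. For (iii), `T f` may be replaced by `-f` when paired with `g ∈ ker
(I + T*)`. -/

namespace PosExt

/-! ### Adjoints via graphs and von Neumann's theorem on `A* A`. -/

section Adjoint

variable {𝕜 E F : Type*} [RCLike 𝕜] [NormedAddCommGroup E] [InnerProductSpace 𝕜 E]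
  [NormedAddCommGroup F] [InnerProductSpace 𝕜 F]

theorem inner_eq_inner_comm {x₁ y₁ : E} {x₂ y₂ : F} :
    inner 𝕜 x₁ y₁ = inner 𝕜 x₂ y₂ ↔ inner 𝕜 y₁ x₁ = inner 𝕜 y₂ x₂ := by
  rw [← inner_conj_symm x₁, ← inner_conj_symm x₂, (RingHom.injective _).eq_iff]

theorem mem_adjoint_graph_iff [CompleteSpace E] {A : E →ₗ.[𝕜] F}
    (hA : Dense (A.domain : Set E)) (y : F) (w : E) :
    (y, w) ∈ A†.graph ↔ ∀ a b, (a, b) ∈ A.graph → inner 𝕜 b y = inner 𝕜 a w := by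
  rw [LinearPMap.adjoint_graph_eq_graph_adjoint hA, Submodule.mem_adjoint_iff]
  simp only [sub_eq_zero]

theorem le_adjoint_adjoint [CompleteSpace E] [CompleteSpace F] {A : E →ₗ.[𝕜] F}
    (hA : Dense (A.domain : Set E)) (hA' : Dense (A†.domain : Set F)) : A ≤ A†† := by
  refine LinearPMap.le_of_le_graph ?_
  rintro ⟨a, b⟩ hab
  rw [mem_adjoint_graph_iff hA']
  intro y w h
  exact inner_eq_inner_comm.1 ((mem_adjoint_graph_iff hA y w).1 h a b hab).symm

theorem adjoint_le_adjoint [CompleteSpace E] {A B : E →ₗ.[𝕜] F}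
    (hA : Dense (A.domain : Set E)) (h : A ≤ B) : B† ≤ A† := by
  have hB : Dense (B.domain : Set E) := hA.mono h.1
  refine LinearPMap.le_of_le_graph ?_
  rintro ⟨y, w⟩ hy
  rw [mem_adjoint_graph_iff hA]
  exact fun a b hab => (mem_adjoint_graph_iff hB y w).1 hy a b (LinearPMap.le_graph_of_le h hab)

theorem adjoint_adjoint_adjoint [CompleteSpace E] [CompleteSpace F] {A : E →ₗ.[𝕜] F}
    (hA : Dense (A.domain : Set E)) (hA' : Dense (A†.domain : Set F)) : A††† = A† := by
  have h := le_adjoint_adjoint hA hA'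
  exact le_antisymm (adjoint_le_adjoint hA h) (le_adjoint_adjoint hA' (hA.mono h.1))

/-- Orthogonal decomposition of a product of Hilbert spaces along a closed subspace. -/
theorem exists_add_orthogonal [CompleteSpace E] [CompleteSpace F] {p : Submodule 𝕜 (E × F)}
    (hp : IsClosed (p : Set (E × F))) (z : E × F) :
    ∃ a ∈ p, ∃ c : E × F, a + c = z ∧
      ∀ q ∈ p, inner 𝕜 q.1 c.1 + inner 𝕜 q.2 c.2 = 0 := by
  -- The product `E × F` carries the sup norm; the projection is taken in the topologically
  -- equivalent Hilbert sum.
  let e := WithLp.prodContinuousLinearEquiv 2 𝕜 E F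
  let p' : Submodule 𝕜 (WithLp 2 (E × F)) := p.comap (e : WithLp 2 (E × F) →ₗ[𝕜] E × F)
  have hp' : IsClosed (p' : Set (WithLp 2 (E × F))) := hp.preimage e.continuous
  have : CompleteSpace p' := hp'.completeSpace_coe
  obtain ⟨a, ha, c, hc, h⟩ := p'.exists_add_mem_mem_orthogonal (e.symm z)
  refine ⟨e a, ha, e c, ?_, fun q hq => ?_⟩
  · rw [← map_add, ← h, e.apply_symm_apply]
  · have hq' : e.symm q ∈ p' := by
      change e (e.symm q) ∈ p
      rwa [e.apply_symm_apply]
    exact (Submodule.mem_orthogonal _ _).1 hc _ hq'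

/-- A positive operator `S` such that `I + S` is surjective is self-adjoint. -/
theorem isSelfAdjoint_of_surjective [CompleteSpace E] {S : E →ₗ.[𝕜] E} (hS : IsPositive S)
    (h : ∀ y, ∃ x w, (x, w) ∈ S.graph ∧ x + w = y) : IsSelfAdjoint S := by
  have hsymm : ∀ a b c d, (a, b) ∈ S.graph → (c, d) ∈ S.graph → inner 𝕜 b c = inner 𝕜 a d := by
    simp only [LinearPMap.mem_graph_iff]
    rintro _ _ _ _ ⟨a, rfl, rfl⟩ ⟨c, rfl, rfl⟩
    exact hS.symm a c
  have hdense : Dense (S.domain : Set E) := by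
    rw [Submodule.dense_iff_topologicalClosure_eq_top,
      Submodule.topologicalClosure_eq_top_iff, Submodule.eq_bot_iff]
    -- If `z = x + S x` is orthogonal to `dom S`, pairing with `x` gives `‖x‖² + ⟪S x, x⟫ = 0`, so
    -- `x = 0`.
    intro z hz
    obtain ⟨x, w, hxw, rfl⟩ := h z
    obtain ⟨x, rfl, rfl⟩ := (LinearPMap.mem_graph_iff _).1 hxw
    have h0 := (Submodule.mem_orthogonal' _ _).1 hz x x.2
    rw [inner_add_left] at h0
    have h1 := congrArg RCLike.re h0
    rw [map_add, map_zero, inner_self_eq_norm_sq] at h1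
    have h2 := hS.nonneg x
    have h3 : ‖(x : E)‖ = 0 := by
      have := sq_nonneg ‖(x : E)‖
      exact pow_eq_zero_iff two_ne_zero |>.1 (by linarith)
    have h4 : x = 0 := Subtype.ext (norm_eq_zero.1 h3)
    simp [h4]
  rw [LinearPMap.isSelfAdjoint_def]
  refine le_antisymm (LinearPMap.le_of_le_graph ?_) (LinearPMap.le_of_le_graph ?_)
  · rintro ⟨g, w⟩ hg
    rw [mem_adjoint_graph_iff hdense] at hg
    -- With `x + S x = g + S* g`, the vector `g - x` is orthogonal to `ran (I + S) = E`, in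
    -- particular to itself.
    obtain ⟨x, v, hxv, hx⟩ := h (g + w)
    have h0 : g - x = 0 := by
      obtain ⟨a, b, hab, h1⟩ := h (g - x)
      refine inner_self_eq_zero (𝕜 := 𝕜).1 ?_
      nth_rw 1 [← h1]
      have hv : v = g + w - x := eq_sub_of_add_eq' hx
      rw [inner_add_left, inner_sub_right b, hg a b hab, hsymm a b x v hab hxv,
        ← inner_sub_right a w v, ← inner_add_right]
      rw [hv]
      convert inner_zero_right a using 2
      abel
    obtain rfl : g = x := sub_eq_zero.1 h0
    obtain rfl : v = w := add_left_cancel hx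
    exact hxv
  · rintro ⟨a, b⟩ hab
    rw [mem_adjoint_graph_iff hdense]
    exact fun c d hcd => hsymm c d a b hcd hab

variable [CompleteSpace E] {A : E →ₗ.[𝕜] F}

theorem isPositive_mulOp_adjoint (hA : Dense (A.domain : Set E)) :
    IsPositive (mulOp A† A) := by
  have key : ∀ z y w v, (y, w) ∈ A†.graph → (z, v) ∈ A.graph →
      inner 𝕜 w z = inner 𝕜 y v := fun z y w v hw hz =>
    inner_eq_inner_comm.1 ((mem_adjoint_graph_iff hA y w).1 hw z v hz).symm
  constructor
  · intro f g
    obtain ⟨y, hy, hy'⟩ := (mem_graph_mulOp A† A _ _).1 (LinearPMap.mem_graph _ f)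
    obtain ⟨v, hv, hv'⟩ := (mem_graph_mulOp A† A _ _).1 (LinearPMap.mem_graph _ g)
    rw [key g y _ v hy' hv, inner_eq_inner_comm, key f v _ y hv' hy]
  · intro f
    obtain ⟨y, hy, hy'⟩ := (mem_graph_mulOp A† A _ _).1 (LinearPMap.mem_graph _ f)
    rw [key f y _ y hy' hy]
    exact inner_self_nonneg

/-- For a closed densely defined operator `A`, the operator `I + A* A` is surjective. -/
theorem exists_add_mulOp_adjoint [CompleteSpace F] (hA : Dense (A.domain : Set E))
    (hc : A.IsClosed) (y : E) :
    ∃ x w, (x, w) ∈ (mulOp A† A).graph ∧ x + w = y := by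
  -- Projecting `(y, 0)` onto the graph of `A` leaves the remainder `(u, -A x)`; its orthogonality
  -- to the graph says `u = A* A x`.
  obtain ⟨⟨x, v⟩, ha, ⟨u, w⟩, h, horth⟩ := exists_add_orthogonal (𝕜 := 𝕜) hc (y, (0 : F))
  obtain ⟨h1, h2⟩ := Prod.ext_iff.1 h
  refine ⟨x, u, (mem_graph_mulOp _ _ _ _).2 ⟨v, ha, ?_⟩, h1⟩
  rw [mem_adjoint_graph_iff hA]
  intro a b hab
  have := horth (a, b) hab
  obtain rfl : v = -w := eq_neg_of_add_eq_zero_left h2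
  rw [inner_neg_right, eq_comm]
  exact eq_neg_of_add_eq_zero_left this

/-- Von Neumann's theorem. -/
theorem isSelfAdjoint_mulOp_adjoint [CompleteSpace F] (hA : Dense (A.domain : Set E))
    (hc : A.IsClosed) :
    IsSelfAdjoint (mulOp A† A) :=
  isSelfAdjoint_of_surjective (isPositive_mulOp_adjoint hA) (exists_add_mulOp_adjoint hA hc)

end Adjoint

/-- Self-adjoint operators are maximal symmetric. -/
theorem eq_of_isSelfAdjoint_of_le {𝕜 E : Type*} [RCLike 𝕜] [NormedAddCommGroup E]
    [InnerProductSpace 𝕜 E] [CompleteSpace E] {R S : E →ₗ.[𝕜] E} (hR : IsSelfAdjoint R)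
    (hS : IsSelfAdjoint S) (h : R ≤ S) : R = S := by
  refine le_antisymm h ?_
  have := adjoint_le_adjoint hR.dense_domain h
  rwa [LinearPMap.isSelfAdjoint_def.1 hR, LinearPMap.isSelfAdjoint_def.1 hS] at this

/-! ### The energy space and the operators `J_T*`, `Q_T`. -/

section Energy

variable {𝕜 H : Type*} [RCLike 𝕜] [NormedAddCommGroup H] [InnerProductSpace 𝕜 H]
  {T : H →ₗ.[𝕜] H} (hT : IsPositive T)

theorem dense_energyEmbedding_domain :
    Dense ((energyEmbedding hT).domain : Set (EnergySpace hT)) := by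
  refine UniformSpace.Completion.denseRange_coe.mono ?_
  rintro _ ⟨y, rfl⟩
  rw [energyEmbedding, Submodule.toLinearPMap_domain]
  exact ⟨_, ⟨y, rfl⟩, rfl⟩

theorem mem_energyEmbedding_graph (hd : Dense (T.domain : Set H)) (a : EnergySpace hT) (b : H) :
    (a, b) ∈ (energyEmbedding hT).graph ↔
      ∃ h : T.domain, ((EnergyRange.mk hT h : EnergyRange hT) : EnergySpace hT) = a ∧ T h = b := by
  constructor
  · intro hab
    rw [energyEmbedding,
      Submodule.toLinearPMap_graph_eq _ (energyEmbeddingGraph_functional hT hd)] at hab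
    obtain ⟨y, hy⟩ := hab
    obtain ⟨h, rfl⟩ := EnergyRange.mk_surjective hT y
    obtain ⟨h1, h2⟩ := Prod.ext_iff.1 hy
    exact ⟨h, h1, h2⟩
  · rintro ⟨h, rfl, rfl⟩
    exact energyEmbedding_apply hT hd h

/-- `dStar T` consists of the `g` for which `T h ↦ ⟪T h, g⟫` is bounded in the energy norm. -/
theorem mem_dStar_iff (g : H) :
    g ∈ dStar T ↔ ∃ C, ∀ h : T.domain, ‖inner 𝕜 (T h) g‖ ≤ C * ‖EnergyRange.mk hT h‖ := by
  constructor
  · intro hg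
    set M : ℝ≥0∞ := ⨆ h : {h : T.domain // RCLike.re (inner 𝕜 (T h) (h : H)) ≤ 1},
      ‖inner 𝕜 (T h.1) g‖ₑ ^ 2
    have hM : M ≠ ∞ := hg.ne
    have hb : ∀ h : T.domain, ‖EnergyRange.mk hT h‖ ≤ 1 →
        ‖inner 𝕜 (T h) g‖ ≤ Real.sqrt M.toReal := by
      intro h hh
      have h1 : ‖inner 𝕜 (T h) g‖ₑ ^ 2 ≤ M :=
        le_iSup (fun h : {h : T.domain // RCLike.re (inner 𝕜 (T h) (h : H)) ≤ 1} =>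
          ‖inner 𝕜 (T h.1) g‖ₑ ^ 2) ⟨h, by
            rw [← norm_mk_sq hT]; exact pow_le_one₀ (norm_nonneg _) hh⟩
      have h2 := ENNReal.toReal_mono hM h1
      rw [ENNReal.toReal_pow, toReal_enorm] at h2
      exact Real.le_sqrt_of_sq_le h2
    refine ⟨Real.sqrt M.toReal, fun h => ?_⟩
    -- The energy seminorm of `h` may vanish, so `h` is scaled by the slightly larger `r`; the
    -- excess costs `C * (ε / (C + 1)) ≤ ε`.
    refine le_of_forall_pos_le_add fun ε hε => ?_
    set C := Real.sqrt M.toReal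
    have hC : 0 ≤ C := Real.sqrt_nonneg _
    have hr : 0 < ‖EnergyRange.mk hT h‖ + ε / (C + 1) := by positivity
    set r := ‖EnergyRange.mk hT h‖ + ε / (C + 1) with hrdef
    have h1 := hb (((r⁻¹ : ℝ) : 𝕜) • h) (by
      rw [map_smul, norm_smul, RCLike.norm_ofReal, abs_of_pos (inv_pos.2 hr),
        inv_mul_le_one₀ hr, hrdef]
      exact le_add_of_nonneg_right (by positivity))
    rw [LinearPMap.map_smul, inner_smul_left, norm_mul, RCLike.norm_conj, RCLike.norm_ofReal,
      abs_of_pos (inv_pos.2 hr), inv_mul_le_iff₀ hr] at h1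
    refine h1.trans ?_
    have h2 : C * (ε / (C + 1)) ≤ ε := by
      rw [← mul_div_assoc, div_le_iff₀ (by positivity)]
      nlinarith
    rw [hrdef]
    nlinarith
  · rintro ⟨C, hC⟩
    refine lt_of_le_of_lt (iSup_le (a := ENNReal.ofReal (|C| ^ 2)) ?_) ENNReal.ofReal_lt_top
    rintro ⟨h, hh⟩
    rw [← norm_mk_sq hT] at hh
    have h1 : ‖EnergyRange.mk hT h‖ ≤ 1 := (sq_le_one_iff₀ (norm_nonneg _)).1 hh
    have h2 : ‖inner 𝕜 (T h) g‖ ≤ |C| := by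
      refine (hC h).trans ?_
      calc C * ‖EnergyRange.mk hT h‖ ≤ |C| * 1 :=
            mul_le_mul (le_abs_self C) h1 (norm_nonneg _) (abs_nonneg C)
        _ = |C| := mul_one _
    rw [ENNReal.ofReal_pow (abs_nonneg C), ← ofReal_norm]
    gcongr

/-- A restriction of a positive operator is positive. -/
theorem IsPositive.of_le {S : H →ₗ.[𝕜] H} (hS : IsPositive S) (hle : T ≤ S) : IsPositive T := by
  have hval : ∀ x : T.domain, T x = S ⟨x, hle.1 x.2⟩ := fun x => hle.2 rfl
  refine ⟨fun x y => ?_, fun x => ?_⟩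
  · rw [hval, hval]
    exact hS.symm ⟨x, hle.1 x.2⟩ ⟨y, hle.1 y.2⟩
  · rw [hval]
    exact hS.nonneg ⟨x, hle.1 x.2⟩

/-- The domain of a positive extension of `T` is contained in `dStar T`. -/
theorem domain_le_dStar {S : H →ₗ.[𝕜] H} (hS : IsPositive S) (hle : T ≤ S) (f : S.domain) :
    (f : H) ∈ dStar T := by
  have hT : IsPositive T := hS.of_le hle
  -- Cauchy–Schwarz in the energy seminorm of `S`, which agrees with that of `T` on `dom T`.
  refine (mem_dStar_iff hT _).2 ⟨‖EnergyRange.mk hS f‖, fun h => ?_⟩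
  have hval : T h = S ⟨h, hle.1 h.2⟩ := hle.2 rfl
  have hnorm : ‖EnergyRange.mk hT h‖ = ‖EnergyRange.mk hS ⟨h, hle.1 h.2⟩‖ := by
    rw [← sq_eq_sq₀ (norm_nonneg _) (norm_nonneg _), norm_mk_sq, norm_mk_sq, hval]
  rw [hnorm, hval, mul_comm, ← EnergyRange.inner_mk hS]
  exact norm_inner_le_norm _ _

theorem mem_adjoint_energyEmbedding_graph (hd : Dense (T.domain : Set H)) (g : H)
    (w : EnergySpace hT) :
    (g, w) ∈ (energyEmbedding hT)†.graph ↔ ∀ h : T.domain,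
      inner 𝕜 (T h) g = inner 𝕜 ((EnergyRange.mk hT h : EnergyRange hT) : EnergySpace hT) w := by
  rw [mem_adjoint_graph_iff (dense_energyEmbedding_domain hT)]
  simp only [mem_energyEmbedding_graph hT hd]
  constructor
  · exact fun h f => h _ _ ⟨f, rfl, rfl⟩
  · rintro h _ _ ⟨f, rfl, rfl⟩
    exact h f

/-- `J_T*` maps `h ∈ dom T` to `T h`. -/
theorem mk_mem_adjoint_energyEmbedding_graph (hd : Dense (T.domain : Set H)) (h : T.domain) :
    ((h : H), ((EnergyRange.mk hT h : EnergyRange hT) : EnergySpace hT)) ∈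
      (energyEmbedding hT)†.graph := by
  rw [mem_adjoint_energyEmbedding_graph hT hd]
  intro f
  rw [UniformSpace.Completion.inner_coe, EnergyRange.inner_mk]

theorem mem_adjoint_energyEmbedding_domain_iff (hd : Dense (T.domain : Set H)) (g : H) :
    g ∈ (energyEmbedding hT)†.domain ↔ g ∈ dStar T := by
  rw [mem_dStar_iff hT]
  constructor
  · intro hg
    obtain ⟨w, hw⟩ := LinearPMap.mem_domain_iff.1 hg
    rw [mem_adjoint_energyEmbedding_graph hT hd] at hw
    refine ⟨‖w‖, fun h => ?_⟩
    rw [hw, mul_comm, ← UniformSpace.Completion.norm_coe (EnergyRange.mk hT h)]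
    exact norm_inner_le_norm _ _
  · rintro ⟨C, hC⟩
    rw [LinearPMap.mem_adjoint_domain_iff]
    refine AddMonoidHomClass.continuous_of_bound
      ((innerₛₗ 𝕜 g).comp (energyEmbedding hT).toFun) C fun x => ?_
    obtain ⟨h, h1, h2⟩ := (mem_energyEmbedding_graph hT hd _ _).1 (LinearPMap.mem_graph _ x)
    change ‖inner 𝕜 g (energyEmbedding hT x)‖ ≤ C * ‖(x : EnergySpace hT)‖
    rw [← h2, ← h1, norm_inner_symm, UniformSpace.Completion.norm_coe]
    exact hC h

theorem dom_le_adjoint_energyEmbedding_domain (hd : Dense (T.domain : Set H)) :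
    T.domain ≤ (energyEmbedding hT)†.domain := fun h hh =>
  LinearPMap.mem_domain_of_mem_graph (mk_mem_adjoint_energyEmbedding_graph hT hd ⟨h, hh⟩)

theorem energyRestrict_le : energyRestrict hT ≤ (energyEmbedding hT)† :=
  LinearPMap.domRestrict_le

theorem energyRestrict_domain (hd : Dense (T.domain : Set H)) :
    (energyRestrict hT).domain = T.domain :=
  inf_eq_left.2 (dom_le_adjoint_energyEmbedding_domain hT hd)

theorem mem_energyRestrict_graph (hd : Dense (T.domain : Set H)) (a : H) (b : EnergySpace hT) :
    (a, b) ∈ (energyRestrict hT).graph ↔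
      ∃ h : T.domain, (h : H) = a ∧
        ((EnergyRange.mk hT h : EnergyRange hT) : EnergySpace hT) = b := by
  have key : ∀ a b, (a, b) ∈ (energyRestrict hT).graph → ∀ h : T.domain, (h : H) = a →
      ((EnergyRange.mk hT h : EnergyRange hT) : EnergySpace hT) = b := by
    rintro _ b hb h rfl
    exact LinearPMap.mem_graph_snd_inj _ (mk_mem_adjoint_energyEmbedding_graph hT hd h)
      (LinearPMap.le_graph_of_le (energyRestrict_le hT) hb) rfl
  constructor
  · intro hab
    have ha := LinearPMap.mem_domain_of_mem_graph hab
    rw [energyRestrict_domain hT hd] at ha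
    exact ⟨⟨a, ha⟩, rfl, key a b hab ⟨a, ha⟩ rfl⟩
  · rintro ⟨h, rfl, rfl⟩
    have hh : (h : H) ∈ (energyRestrict hT).domain := by
      rw [energyRestrict_domain hT hd]; exact h.2
    obtain ⟨b, hb⟩ := LinearPMap.mem_domain_iff.1 hh
    rwa [key _ b hb h rfl]

theorem dense_energyRestrict_domain (hd : Dense (T.domain : Set H)) :
    Dense ((energyRestrict hT).domain : Set H) := by
  rwa [energyRestrict_domain hT hd]

theorem dense_adjoint_energyEmbedding_domain (hd : Dense (T.domain : Set H)) :
    Dense ((energyEmbedding hT)†.domain : Set H) :=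
  hd.mono (dom_le_adjoint_energyEmbedding_domain hT hd)

variable [CompleteSpace H]

theorem mem_adjoint_energyRestrict_graph (hd : Dense (T.domain : Set H)) (y : EnergySpace hT)
    (x : H) :
    (y, x) ∈ (energyRestrict hT)†.graph ↔ ∀ h : T.domain,
      inner 𝕜 ((EnergyRange.mk hT h : EnergyRange hT) : EnergySpace hT) y = inner 𝕜 (h : H) x := by
  rw [mem_adjoint_graph_iff (dense_energyRestrict_domain hT hd)]
  simp only [mem_energyRestrict_graph hT hd]
  constructor
  · exact fun h f => h _ _ ⟨f, rfl, rfl⟩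
  · rintro h _ _ ⟨f, rfl, rfl⟩
    exact h f

/-- From `J_T ⊆ J_T** ⊆ Q_T*`. This makes `Q_T*` densely defined, so that `Q_T**` is a genuine
adjoint. -/
theorem energyEmbedding_le_adjoint_energyRestrict (hd : Dense (T.domain : Set H)) :
    energyEmbedding hT ≤ (energyRestrict hT)† :=
  (le_adjoint_adjoint (dense_energyEmbedding_domain hT)
    (dense_adjoint_energyEmbedding_domain hT hd)).trans
    (adjoint_le_adjoint (dense_energyRestrict_domain hT hd) (energyRestrict_le hT))

theorem dense_adjoint_energyRestrict_domain (hd : Dense (T.domain : Set H)) :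
    Dense ((energyRestrict hT)†.domain : Set (EnergySpace hT)) :=
  (dense_energyEmbedding_domain hT).mono (energyEmbedding_le_adjoint_energyRestrict hT hd).1

theorem energyRestrict_le_adjoint_adjoint (hd : Dense (T.domain : Set H)) :
    energyRestrict hT ≤ (energyRestrict hT)†† :=
  le_adjoint_adjoint (dense_energyRestrict_domain hT hd) (dense_adjoint_energyRestrict_domain hT hd)

theorem dense_adjoint_adjoint_energyRestrict_domain (hd : Dense (T.domain : Set H)) :
    Dense ((energyRestrict hT)††.domain : Set H) :=
  (dense_energyRestrict_domain hT hd).mono (energyRestrict_le_adjoint_adjoint hT hd).1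

theorem adjoint_adjoint_energyRestrict_le (hd : Dense (T.domain : Set H)) :
    (energyRestrict hT)†† ≤ (energyEmbedding hT)† :=
  adjoint_le_adjoint (dense_energyEmbedding_domain hT)
    (energyEmbedding_le_adjoint_energyRestrict hT hd)

/-! ### The two extremal extensions. -/

/-- Brings `T_F` into the form `B* B` with `B = Q_T**` closed, as von Neumann's theorem requires. -/
theorem friedrichs_eq (hd : Dense (T.domain : Set H)) :
    friedrichs hT = mulOp (energyRestrict hT)††† (energyRestrict hT)†† := by
  rw [adjoint_adjoint_adjoint (dense_energyRestrict_domain hT hd)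
    (dense_adjoint_energyRestrict_domain hT hd), friedrichs]

theorem isPosSelfAdjointExtension_kreinVonNeumann (hd : Dense (T.domain : Set H)) :
    IsPosSelfAdjointExtension T (kreinVonNeumann hT) := by
  have hA := dense_adjoint_energyEmbedding_domain hT hd
  have hJ := dense_energyEmbedding_domain hT
  refine ⟨isSelfAdjoint_mulOp_adjoint hA (LinearPMap.adjoint_isClosed hJ),
    isPositive_mulOp_adjoint hA, LinearPMap.le_of_le_graph ?_⟩
  rintro ⟨x, z⟩ hx
  obtain ⟨h, rfl, rfl⟩ := (LinearPMap.mem_graph_iff _).1 hx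
  exact (mem_graph_mulOp _ _ _ _).2 ⟨_, mk_mem_adjoint_energyEmbedding_graph hT hd h,
    LinearPMap.le_graph_of_le (le_adjoint_adjoint hJ hA) (energyEmbedding_apply hT hd h)⟩

theorem isPosSelfAdjointExtension_friedrichs (hd : Dense (T.domain : Set H)) :
    IsPosSelfAdjointExtension T (friedrichs hT) := by
  have hB := dense_adjoint_adjoint_energyRestrict_domain hT hd
  have hle : T ≤ friedrichs hT := by
    refine LinearPMap.le_of_le_graph ?_
    rintro ⟨x, z⟩ hx
    obtain ⟨h, rfl, rfl⟩ := (LinearPMap.mem_graph_iff _).1 hx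
    exact (mem_graph_mulOp _ _ _ _).2 ⟨_,
      LinearPMap.le_graph_of_le (energyRestrict_le_adjoint_adjoint hT hd)
        ((mem_energyRestrict_graph hT hd _ _).2 ⟨h, rfl, rfl⟩),
      LinearPMap.le_graph_of_le (energyEmbedding_le_adjoint_energyRestrict hT hd)
        (energyEmbedding_apply hT hd h)⟩
  rw [friedrichs_eq hT hd] at hle ⊢
  exact ⟨isSelfAdjoint_mulOp_adjoint hB
    (LinearPMap.adjoint_isClosed (dense_adjoint_energyRestrict_domain hT hd)),
    isPositive_mulOp_adjoint hB, hle⟩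

/-! ### The kernel of `I + T*` and uniqueness. -/

theorem mem_ker_id_vadd_adjoint_iff (hd : Dense (T.domain : Set H)) (g : H) :
    g ∈ ker ((LinearMap.id : H →ₗ[𝕜] H) +ᵥ T†) ↔
      ∀ f : T.domain, inner 𝕜 (T f) g = -inner 𝕜 (f : H) g := by
  have h1 : g ∈ ker ((LinearMap.id : H →ₗ[𝕜] H) +ᵥ T†) ↔ (g, -g) ∈ T†.graph := by
    rw [LinearPMap.mem_graph_iff]
    constructor
    · rintro ⟨y, hy, rfl⟩
      exact ⟨y, rfl, eq_neg_of_add_eq_zero_right hy⟩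
    · rintro ⟨y, hy, hy'⟩
      refine ⟨y, ?_, hy⟩
      change (y : H) + T† y = 0
      rw [hy', hy]
      exact add_neg_cancel g
  rw [h1, mem_adjoint_graph_iff hd]
  simp only [inner_neg_right]
  exact ⟨fun h f => h f (T f) (LinearPMap.mem_graph T f), fun h a b hab => by
    obtain ⟨f, rfl, rfl⟩ := (LinearPMap.mem_graph_iff _).1 hab
    exact h f⟩

/-- If `ker (I + T*)` meets `dStar T` trivially, then `dom T` is a core for `J_T*`. -/
theorem adjoint_adjoint_energyRestrict_eq (hd : Dense (T.domain : Set H))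
    (h : (ker ((LinearMap.id : H →ₗ[𝕜] H) +ᵥ T†) : Set H) ∩ dStar T = {0}) :
    (energyRestrict hT)†† = (energyEmbedding hT)† := by
  have hle := LinearPMap.le_graph_of_le (adjoint_adjoint_energyRestrict_le hT hd)
  refine le_antisymm (adjoint_adjoint_energyRestrict_le hT hd) (LinearPMap.le_of_le_graph ?_)
  intro z hz
  -- The remainder `(u, v)` stays in the graph of `J_T*`; orthogonality to all `(f, T f)` then puts
  -- `u` in `ker (I + T*)`.
  obtain ⟨a, ha, ⟨u, v⟩, rfl, horth⟩ := exists_add_orthogonal (𝕜 := 𝕜)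
    (LinearPMap.adjoint_isClosed (dense_adjoint_energyRestrict_domain hT hd)) z
  have hu : (u, v) ∈ (energyEmbedding hT)†.graph :=
    ((energyEmbedding hT)†.graph.add_mem_iff_right (hle ha)).1 hz
  have hu0 : u ∈ (ker ((LinearMap.id : H →ₗ[𝕜] H) +ᵥ T†) : Set H) ∩ dStar T := by
    refine ⟨(mem_ker_id_vadd_adjoint_iff hd u).2 fun f => ?_,
      (mem_adjoint_energyEmbedding_domain_iff hT hd u).1 (LinearPMap.mem_domain_of_mem_graph hu)⟩
    rw [(mem_adjoint_energyEmbedding_graph hT hd u v).1 hu f]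
    exact eq_neg_of_add_eq_zero_right (horth _
      (LinearPMap.le_graph_of_le (energyRestrict_le_adjoint_adjoint hT hd)
        ((mem_energyRestrict_graph hT hd _ _).2 ⟨f, rfl, rfl⟩)))
  rw [h, Set.mem_singleton_iff] at hu0
  subst hu0
  obtain rfl : v = 0 := LinearPMap.graph_fst_eq_zero_snd _ hu rfl
  rw [show ((0 : H), (0 : EnergySpace hT)) = 0 from rfl, add_zero]
  exact ha

include hT in
theorem singleton_zero_subset_ker_inter_dStar :
    ({0} : Set H) ⊆ (ker ((LinearMap.id : H →ₗ[𝕜] H) +ᵥ T†) : Set H) ∩ dStar T :=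
  Set.singleton_subset_iff.2 ⟨Submodule.zero_mem _, (mem_dStar_iff hT _).2 ⟨0, fun h => by simp⟩⟩

/-- For `f ∈ dom S`, symmetry of `S` gives `⟪T h, J_T* f⟫_T = ⟪T h, f⟫ = ⟪h, S f⟫`, so `Q_T* J_T* f
= S f`. Hence `S ⊆ T_F`, and self-adjoint operators are maximal. -/
theorem eq_friedrichs_of_core (hd : Dense (T.domain : Set H))
    (hcore : (energyRestrict hT)†† = (energyEmbedding hT)†) {S : H →ₗ.[𝕜] H}
    (hS : IsPosSelfAdjointExtension T S) : S = friedrichs hT := by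
  obtain ⟨hSa, hSp, hle⟩ := hS
  refine eq_of_isSelfAdjoint_of_le hSa (isPosSelfAdjointExtension_friedrichs hT hd).1
    (LinearPMap.le_of_le_graph ?_)
  rintro ⟨x, z⟩ hx
  obtain ⟨f, rfl, rfl⟩ := (LinearPMap.mem_graph_iff _).1 hx
  obtain ⟨w, hw⟩ := LinearPMap.mem_domain_iff.1
    ((mem_adjoint_energyEmbedding_domain_iff hT hd _).2 (domain_le_dStar hSp hle f))
  refine (mem_graph_mulOp _ _ _ _).2 ⟨w, by rwa [hcore],
    (mem_adjoint_energyRestrict_graph hT hd _ _).2 fun h => ?_⟩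
  have hval : T h = S ⟨h, hle.1 h.2⟩ := hle.2 rfl
  rw [← (mem_adjoint_energyEmbedding_graph hT hd _ _).1 hw h, hval]
  exact hSp.symm _ f

theorem inter_dStar_eq_of_kreinVonNeumann_eq_friedrichs (hd : Dense (T.domain : Set H))
    (heq : kreinVonNeumann hT = friedrichs hT) :
    (ker ((LinearMap.id : H →ₗ[𝕜] H) +ᵥ T†) : Set H) ∩ dStar T = {0} := by
  refine Set.Subset.antisymm ?_ (singleton_zero_subset_ker_inter_dStar hT)
  rintro g ⟨hg, hg'⟩
  rw [SetLike.mem_coe, mem_ker_id_vadd_adjoint_iff hd] at hg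
  obtain ⟨v, hv⟩ := LinearPMap.mem_domain_iff.1
    ((mem_adjoint_energyEmbedding_domain_iff hT hd g).2 hg')
  obtain ⟨f, w, hfw, hf⟩ := exists_add_mulOp_adjoint
    (dense_adjoint_energyEmbedding_domain hT hd)
    (LinearPMap.adjoint_isClosed (dense_energyEmbedding_domain hT)) g
  obtain ⟨y, hfy, hyw⟩ := (mem_graph_mulOp _ _ _ _).1 hfw
  have hfw' : (f, w) ∈ (friedrichs hT).graph := heq ▸ hfw
  obtain ⟨y', hfy', -⟩ := (mem_graph_mulOp _ _ _ _).1 hfw'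
  -- The hypothesis `T_N = T_F` enters here: `f` lies in `dom Q_T**`, where `Q_T**` agrees with
  -- `J_T*`.
  obtain rfl : y = y' := LinearPMap.mem_graph_snd_inj _ hfy
    (LinearPMap.le_graph_of_le (adjoint_adjoint_energyRestrict_le hT hd) hfy') rfl
  -- Membership of `g` in `ker (I + T*)` means `Q_T* v = -g` for `v = J_T* g`.
  have h1 : inner 𝕜 v y = inner 𝕜 (-g) f := by
    refine ((mem_adjoint_graph_iff (dense_adjoint_energyRestrict_domain hT hd) _ _).1 hfy'
      _ _ ?_).symm
    rw [mem_adjoint_energyRestrict_graph hT hd]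
    intro h
    rw [← (mem_adjoint_energyEmbedding_graph hT hd _ _).1 hv, hg, inner_neg_right]
  have h2 : inner 𝕜 v y = inner 𝕜 g w :=
    (mem_adjoint_graph_iff (dense_adjoint_energyEmbedding_domain hT hd) _ _).1 hyw _ _ hv
  rw [Set.mem_singleton_iff, ← inner_self_eq_zero (𝕜 := 𝕜)]
  nth_rw 2 [← hf]
  rw [inner_add_right, ← h2, h1, inner_neg_left, add_neg_cancel]

end Energy

end PosExt

theorem mainTheorem7 {𝕜 : Type*} {H : Type*} [RCLike 𝕜] [NormedAddCommGroup H]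
    [InnerProductSpace 𝕜 H] [CompleteSpace H] (T : H →ₗ.[𝕜] H)
    (hd : Dense (T.domain : Set H)) (hT : PosExt.IsPositive T) :
    List.TFAE
      [∃! S : H →ₗ.[𝕜] H, PosExt.IsPosSelfAdjointExtension T S,
        PosExt.kreinVonNeumann hT = PosExt.friedrichs hT,
        (PosExt.ker ((LinearMap.id : H →ₗ[𝕜] H) +ᵥ T†) : Set H) ∩ PosExt.dStar T = {0},
        ∀ g ∈ PosExt.ker ((LinearMap.id : H →ₗ[𝕜] H) +ᵥ T†), g ≠ 0 →
          (⨆ f : {f : T.domain // RCLike.re (inner 𝕜 (T f) (f : H)) ≤ 1},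
            ‖inner 𝕜 (f.1 : H) g‖ₑ ^ 2) = ∞] := by
  tfae_have 1 → 2 := fun h =>
    h.unique (PosExt.isPosSelfAdjointExtension_kreinVonNeumann hT hd)
      (PosExt.isPosSelfAdjointExtension_friedrichs hT hd)
  tfae_have 2 → 3 := PosExt.inter_dStar_eq_of_kreinVonNeumann_eq_friedrichs hT hd
  tfae_have 3 → 1 := fun h =>
    ⟨_, PosExt.isPosSelfAdjointExtension_friedrichs hT hd, fun _ hS =>
      PosExt.eq_friedrichs_of_core hT hd (PosExt.adjoint_adjoint_energyRestrict_eq hT hd h) hS⟩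
  -- On the kernel `⟪T f, g⟫ = -⟪f, g⟫`, so the suprema in (ii) and (iii) coincide.
  have hmem : ∀ g ∈ PosExt.ker ((LinearMap.id : H →ₗ[𝕜] H) +ᵥ T†), g ∈ PosExt.dStar T ↔
      (⨆ f : {f : T.domain // RCLike.re (inner 𝕜 (T f) (f : H)) ≤ 1},
        ‖inner 𝕜 (f.1 : H) g‖ₑ ^ 2) ≠ ∞ := by
    intro g hg
    rw [PosExt.mem_ker_id_vadd_adjoint_iff hd] at hg
    rw [← lt_top_iff_ne_top]
    simp only [PosExt.dStar, Set.mem_ofPred_eq, hg, enorm_neg]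
  tfae_have 3 → 4 := by
    intro h g hg hg0
    by_contra hne
    have : g ∈ ({0} : Set H) := h ▸ ⟨hg, (hmem g hg).2 hne⟩
    exact hg0 this
  tfae_have 4 → 3 := by
    intro h
    refine Set.Subset.antisymm ?_ (PosExt.singleton_zero_subset_ker_inter_dStar hT)
    rintro g ⟨hg, hg'⟩
    by_contra hg0
    exact (hmem g hg).1 hg' (h g hg hg0)
  tfae_finish
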